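/- Let $d\ge 1$ and let $Y_d=\mathbb{R}^d/\mathbb{Z}^d$, identified with the cube $[0,1)^d$. Let $C^1_\sharp(Y_d)$ be the space of real-valued $\mathbb{Z}^d$-periodic functions of class $C^1$ on $\mathbb{R}^d$. For a vector field $b\in C^1_\sharp(Y_d)^d$ let $X$ be its flow, i.e. $\partial_t X(t,x)=b(X(t,x))$ for $t\in\mathbb{R}$ and $X(0,x)=x$. Let $\mathscr{I}_b$ be the set of Borel probability measures $\mu$ on $Y_d$ that are invariant for $X$, i.e. $\int_{Y_d}\psi(X(t,y))\,d\mu(y)=\int_{Y_d}\psi(y)\,d\mu(y)$ for all $t\in\mathbb{R}$ and all continuous $\mathbb{Z}^d$-periodic $\psi:\mathbb{R}^d\to\mathbb{R}$. Let $\mathsf{C}_b=\left\{\int_{Y_d}b\,d\mu:\mu\in\mathscr{I}_b\right\}\subset\mathbb{R}^d$ be Herman's rotation set. For a non-negative periodic function $a$ let $\underline{a}=\left(\int_{Y_d}\frac{dy}{a(y)}\right)^{-1}$ be its harmonic mean (with $1/0=\infty$ and $1/\infty=0$). Let $b=\rho\,\Phi\in C^1_\sharp(Y_d)^d$, where $\rho\in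 C^1_\sharp(Y_d)$ is non-negative and not identically zero, and $\Phi\in C^1_\sharp(Y_d)^d$ is a nowhere vanishing vector field. Assume that there is a sequence $(\rho_n)_{n\in\mathbb{N}}$ in $C^1_\sharp(Y_d)$ such that (i) for every $n$, $\rho_n>0$ and $\rho_n\ge\rho$, and $\rho_n\to\rho$ uniformly on $Y_d$; (ii) for every $n$, there is $\zeta_n\in\mathbb{R}^d$ such that $\mathsf{C}_{b_n}=\{\zeta_n\}$, where $b_n=\rho_n\,\Phi$. Assume moreover that $\rho$ vanishes at some point of $Y_d$, and that there is a positive function $\sigma\in C^1_\sharp(Y_d)$ such that $\sigma\,\Phi$ is divergence free in $\mathbb{R}^d$. Then: - if $\underline{\rho/\sigma}=0$, the flow $X$ of $b$ satisfies $\displaystyle\lim_{t\to\infty}\frac{X(t,x)}{t}=0$ for every $x$; - if $\underline{\rho/\sigma}>0$, then $\mathsf{C}_b=[0,\zeta]$, the closed line segment of $\mathbb{R}^d$ from $0$ to $\displaystyle\zeta=\underline{\rho/\sigma}\int_{Y_d}\Phi(y)\,\sigma(y)\,dy$. -/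

import Mathlib

open MeasureTheory Filter Topology
open scoped ENNReal

namespace TorusFlow

/-- The Euclidean space `ℝ^d`. -/
abbrev E (d : ℕ) : Type := EuclideanSpace ℝ (Fin d)

/-- `ℤ^d`-periodicity of a function on `ℝ^d`. -/
def Periodic {d : ℕ} {F : Type*} (f : E d → F) : Prop :=
  ∀ (κ : Fin d → ℤ) (x : E d), f (x + WithLp.toLp 2 (fun i => (κ i : ℝ))) = f x

/-- `f ∈ C^1_♯(Y_d)` (scalar or vector valued): `f` is of class `C^1` on `ℝ^d` and
`ℤ^d`-periodic. -/
structure C1Periodic {d : ℕ} {F : Type*} [NormedAddCommGroup F] [NormedSpace ℝ F]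
    (f : E d → F) : Prop where
  contDiff : ContDiff ℝ 1 f
  periodic : Periodic f

/-- The unit cube `[0,1)^d`, a fundamental domain with which the torus `Y_d = ℝ^d / ℤ^d` is
identified. -/
def cell (d : ℕ) : Set (E d) := {x | ∀ i, x i ∈ Set.Ico (0 : ℝ) 1}

/-- `X` is the flow of the vector field `b`: for every `x`, the curve `t ↦ X t x` solves
`∂X/∂t = b(X)` on the whole of `ℝ`, with `X 0 x = x`. -/
def IsFlow {d : ℕ} (b : E d → E d) (X : ℝ → E d → E d) : Prop :=
  ∀ x, X 0 x = x ∧ ∀ t, HasDerivAt (fun s => X s x) (b (X t x)) t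

/-- The flow of the vector field `b`. For `b ∈ C^1_♯(Y_d)^d` it exists and is unique, see
`isFlow_flow` and `IsFlow.eq_flow` below. -/
noncomputable def flow {d : ℕ} (b : E d → E d) : ℝ → E d → E d :=
  Classical.epsilon (IsFlow b)

/-- A continuous periodic function is bounded. -/
theorem Periodic.bounded {d : ℕ} {F : Type*} [NormedAddCommGroup F] {f : E d → F}
    (hf : Periodic f) (hc : Continuous f) : ∃ C : NNReal, ∀ x, ‖f x‖ ≤ C := by
  have hK : IsCompact ((WithLp.toLp 2 : (Fin d → ℝ) → E d) ''
      (Set.pi Set.univ fun _ => Set.Icc (0 : ℝ) 1)) :=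
    (isCompact_univ_pi fun _ => isCompact_Icc).image (PiLp.continuous_toLp 2 _)
  obtain ⟨C, hC⟩ := hK.exists_bound_of_continuousOn hc.continuousOn
  refine ⟨C.toNNReal, fun x => ?_⟩
  have h1 := hf (fun i => -⌊x i⌋) x
  rw [← h1]
  refine (hC _ ⟨fun i => Int.fract (x i), ?_, ?_⟩).trans (Real.le_coe_toNNReal C)
  · intro i _
    exact ⟨Int.fract_nonneg _, (Int.fract_lt_one _).le⟩
  · ext i
    simp [Int.fract, sub_eq_add_neg]

/-- A `C^1` periodic function is globally Lipschitz. -/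
theorem C1Periodic.lipschitz {d : ℕ} {F : Type*} [NormedAddCommGroup F] [NormedSpace ℝ F]
    {f : E d → F} (hf : C1Periodic f) : ∃ K : NNReal, LipschitzWith K f := by
  have hp : Periodic (fderiv ℝ f) := by
    intro κ x
    have h : (fun y => f (y + WithLp.toLp 2 (fun i => (κ i : ℝ)))) = f := funext (hf.periodic κ)
    rw [← fderiv_comp_add_right, h]
  obtain ⟨K, hK⟩ := hp.bounded (hf.contDiff.continuous_fderiv one_ne_zero)
  exact ⟨K, lipschitzWith_of_nnnorm_fderiv_le (hf.contDiff.differentiable one_ne_zero)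
    fun x => hK x⟩

theorem exists_isFlow {d : ℕ} {b : E d → E d} (hb : C1Periodic b) : ∃ X, IsFlow b X := by
  obtain ⟨K, hK⟩ := hb.lipschitz
  obtain ⟨M, hM⟩ := hb.periodic.bounded hb.contDiff.continuous
  have key : ∀ (x : E d) (T : ℝ), 0 < T → ∃ γ : ℝ → E d, γ 0 = x ∧
      ∀ t ∈ Set.Ioo (-T) T, HasDerivAt γ (b (γ t)) t := by
    intro x T hT
    have h0 : (0 : ℝ) ∈ Set.Icc (-T) T := ⟨by linarith, hT.le⟩
    have hP : IsPicardLindelof (fun _ => b) (⟨0, h0⟩ : Set.Icc (-T) T) x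
        (M * T.toNNReal) 0 M K := by
      refine IsPicardLindelof.of_time_independent (fun y _ => hM y) (hK.lipschitzOnWith) ?_
      simp [Real.coe_toNNReal T hT.le]
    obtain ⟨γ, h1, h2⟩ := hP.exists_eq_forall_mem_Icc_hasDerivWithinAt₀
    exact ⟨γ, h1, fun t ht =>
      (h2 t (Set.Ioo_subset_Icc_self ht)).hasDerivAt (Icc_mem_nhds ht.1 ht.2)⟩
  have hpos : ∀ t : ℝ, 0 < |t| + 1 := fun t => by positivity
  choose γ hγ0 hγ using key
  refine ⟨fun t x => γ x (|t| + 1) (hpos t) t, fun x => ⟨hγ0 _ _ _, fun t => ?_⟩⟩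
  refine (hγ x (|t| + 1) (hpos t) t (abs_lt.1 (lt_add_one _))).congr_of_eventuallyEq ?_
  have hn : Set.Ioo (-(|t| + 1)) (|t| + 1) ∈ 𝓝 t :=
    Ioo_mem_nhds (abs_lt.1 (lt_add_one _)).1 (abs_lt.1 (lt_add_one _)).2
  filter_upwards [hn] with s hs
  set m := min (|s| + 1) (|t| + 1)
  have hm : 0 < m := lt_min (hpos s) (hpos t)
  refine ODE_solution_unique_of_mem_Ioo (v := fun _ => b) (s := fun _ => Set.univ) (K := K)
    (a := -m) (b := m) (t₀ := 0) (fun _ _ => hK.lipschitzOnWith) ⟨by linarith, hm⟩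
    (fun r hr => ⟨hγ x _ (hpos s) r ⟨?_, ?_⟩, trivial⟩)
    (fun r hr => ⟨hγ x _ (hpos t) r ⟨?_, ?_⟩, trivial⟩) ?_ ?_
  · have := min_le_left (|s| + 1) (|t| + 1); linarith [hr.1]
  · have := min_le_left (|s| + 1) (|t| + 1); linarith [hr.2]
  · have := min_le_right (|s| + 1) (|t| + 1); linarith [hr.1]
  · have := min_le_right (|s| + 1) (|t| + 1); linarith [hr.2]
  · rw [hγ0, hγ0]
  · exact abs_lt.1 (lt_min (lt_add_one _) (abs_lt.2 hs))

theorem isFlow_flow {d : ℕ} {b : E d → E d} (hb : C1Periodic b) : IsFlow b (flow b) :=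
  Classical.epsilon_spec (exists_isFlow hb)

theorem IsFlow.eq_flow {d : ℕ} {b : E d → E d} (hb : C1Periodic b) {X : ℝ → E d → E d}
    (hX : IsFlow b X) : X = flow b := by
  obtain ⟨K, hK⟩ := hb.lipschitz
  funext t x
  have h := isFlow_flow hb
  exact congrFun (ODE_solution_unique_univ (v := fun _ => b) (s := fun _ => Set.univ) (t₀ := 0)
    (fun _ => hK.lipschitzOnWith)
    (fun t => ⟨(hX x).2 t, trivial⟩) (fun t => ⟨(h x).2 t, trivial⟩)
    ((hX x).1.trans (h x).1.symm)) t

/-- The set `𝓘_b` of the Borel probability measures on the torus (identified with the cube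
`[0,1)^d`) which are invariant for the flow `X` of `b`:
`∫ ψ(X(t,y)) dμ(y) = ∫ ψ(y) dμ(y)` for all `t ∈ ℝ` and all continuous `ℤ^d`-periodic `ψ`. -/
def invariantMeasures {d : ℕ} (b : E d → E d) : Set (Measure (E d)) :=
  {μ | IsProbabilityMeasure μ ∧ μ (cell d)ᶜ = 0 ∧
    ∀ (t : ℝ) (ψ : E d → ℝ), Continuous ψ → Periodic ψ →
      ∫ y, ψ (flow b t y) ∂μ = ∫ y, ψ y ∂μ}

/-- Herman's rotation set `C_b = {∫ b dμ : μ ∈ 𝓘_b}`. -/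
def hermanSet {d : ℕ} (b : E d → E d) : Set (E d) :=
  {z | ∃ μ ∈ invariantMeasures b, ∫ y, b y ∂μ = z}

/-- The harmonic mean `(∫_{Y_d} dy / a(y))⁻¹ ∈ [0,∞]` of a non negative periodic function `a`,
with the conventions `1/0 = ∞` and `1/∞ = 0`. -/
noncomputable def harmonicMean {d : ℕ} (a : E d → ℝ) : ℝ≥0∞ :=
  (∫⁻ y in cell d, (ENNReal.ofReal (a y))⁻¹)⁻¹

/-- The divergence of a vector field on `ℝ^d`. -/
noncomputable def divergence {d : ℕ} (F : E d → E d) (x : E d) : ℝ :=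
  ∑ i, (fderiv ℝ F x (EuclideanSpace.single i 1)) i

end TorusFlow

/-!
Write `X` for the flow of `b = ρ • Φ`, `Xₙ` for the flow of `bₙ = ρₙ • Φ`, `w = ∫ σ • Φ`, and
`Hₙ`, `H` for the harmonic means of `ρₙ / σ`, `ρ / σ`. The fields `b`, `bₙ` and `σ • Φ` are all
parallel to `Φ`, so `b` and `σ • Φ` move points along the orbits of `bₙ`, with another clock. Such a
change of time acts on invariant measures by multiplication by a density: if `ν` is invariant for
`c • b'`, then `c • ν` is invariant for `b'`, even if `c` vanishes somewhere
(`IsInvariant.integral_mul_comp_flow`). The proof tests invariance on the functions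
`u x = ∫₀ᵀ ψ(X'(s,x)) ds`, with `X'` the flow of `b'`, which are differentiable along the flow for
every continuous `ψ`; no differentiability of the flow in space is used.

The field `σ • Φ` preserves Lebesgue measure (`isInvariant_restrict_cell`), so `σ / ρₙ` is an
invariant density for `bₙ`, and the only point of its rotation set is `ζₙ = Hₙ • w`
(`smul_setIntegral_mem_hermanSet`). Conversely, if `μ` is an invariant probability measure of `b`,
then `(ρ / ρₙ) • μ` is invariant for `bₙ`, hence `∫ b dμ = mₙ • ζₙ` with `mₙ = ∫ ρ / ρₙ dμ ∈ [0, 1]`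
(`integral_eq_smul_of_hermanSet_eq_singleton`). By Fatou's lemma and `ρₙ ≥ ρ`, `Hₙ → H`, including
when `H = 0`; so the rotation set of `b` lies in the segment `[0, H • w]`
(`hermanSet_subset_segment`).

If `H = 0`, the rotation set is contained in `{0}`, and limits of the empirical measures of an
orbit, which are invariant, show that `X(t,x) / t → 0`
(`tendsto_inv_smul_flow_of_hermanSet_subset`). If `H > 0`, the density `σ / ρ` is integrable and, by
passage to the limit from `σ / ρₙ`, invariant for `b`; this gives the endpoint `H • w`
(`harmonicMean_smul_mem_hermanSet`). The endpoint `0` comes from a Dirac mass at a zero of `ρ`, and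
the rotation set is convex.
-/

namespace TorusFlow

variable {d : ℕ} {b : E d → E d}

/-! ### The flow of a periodic vector field -/

theorem hasDerivAt_flow (hb : C1Periodic b) (t : ℝ) (x : E d) :
    HasDerivAt (fun s => flow b s x) (b (flow b t x)) t :=
  (isFlow_flow hb x).2 t

theorem flow_zero (hb : C1Periodic b) (x : E d) : flow b 0 x = x :=
  (isFlow_flow hb x).1

theorem eq_flow_of_hasDerivAt (hb : C1Periodic b) {γ : ℝ → E d}
    (hγ : ∀ t, HasDerivAt γ (b (γ t)) t) (t : ℝ) : γ t = flow b t (γ 0) := by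
  obtain ⟨K, hK⟩ := hb.lipschitz
  exact congrFun (ODE_solution_unique_univ (v := fun _ => b) (s := fun _ => Set.univ) (t₀ := 0)
    (fun _ => hK.lipschitzOnWith) (fun t => ⟨hγ t, trivial⟩)
    (fun t => ⟨hasDerivAt_flow hb t (γ 0), trivial⟩) (flow_zero hb _).symm) t

theorem flow_add (hb : C1Periodic b) (s t : ℝ) (x : E d) :
    flow b (s + t) x = flow b s (flow b t x) := by
  have h := eq_flow_of_hasDerivAt hb (γ := fun s => flow b (s + t) x)
    (fun s => (hasDerivAt_flow hb (s + t) x).comp_add_const s t) s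
  simpa using h

theorem flow_add_intCast (hb : C1Periodic b) (t : ℝ) (x : E d) (κ : Fin d → ℤ) :
    flow b t (x + WithLp.toLp 2 (fun i => (κ i : ℝ))) =
      flow b t x + WithLp.toLp 2 (fun i => (κ i : ℝ)) := by
  have h := eq_flow_of_hasDerivAt hb
    (γ := fun s => flow b s x + WithLp.toLp 2 (fun i => (κ i : ℝ)))
    (fun s => by
      rw [hb.periodic]
      exact (hasDerivAt_flow hb s x).add_const _) t
  simpa [flow_zero hb] using h.symm

theorem flow_eq_self (hb : C1Periodic b) {x : E d} (hx : b x = 0) (t : ℝ) : flow b t x = x :=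
  (eq_flow_of_hasDerivAt hb (γ := fun _ => x) (fun s => by
    rw [hx]; exact hasDerivAt_const s x) t).symm

theorem C1Periodic.neg (hb : C1Periodic b) : C1Periodic (fun x => -b x) :=
  ⟨hb.contDiff.neg, fun κ x => by simp only [hb.periodic κ x]⟩

theorem flow_neg (hb : C1Periodic b) (t : ℝ) (x : E d) :
    flow b (-t) x = flow (fun x => -b x) t x := by
  have h := eq_flow_of_hasDerivAt hb.neg (γ := fun s => flow b (-s) x)
    (fun s => by
      have h := (hasDerivAt_flow hb (-s) x).scomp s (hasDerivAt_neg s)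
      rw [neg_one_smul] at h
      exact h) t
  simpa [flow_zero hb] using h

/-- Grönwall's inequality for the flows of two vector fields. -/
theorem dist_flow_flow_le {b' : E d → E d} (hb : C1Periodic b) (hb' : C1Periodic b')
    {K : NNReal} (hK : LipschitzWith K b) {ε : ℝ} (hε : ∀ x, dist (b' x) (b x) ≤ ε)
    (x y : E d) {t : ℝ} (ht : 0 ≤ t) :
    dist (flow b t x) (flow b' t y) ≤ gronwallBound (dist x y) K ε t := by
  have h := dist_le_of_approx_trajectories_ODE (v := fun _ => b) (K := K) (a := 0) (b := t)
    (f := fun s => flow b s x) (g := fun s => flow b' s y) (f' := fun s => b (flow b s x))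
    (g' := fun s => b' (flow b' s y)) (εf := 0) (εg := ε) (δ := dist x y)
    (fun _ => hK) (fun s _ => (hasDerivAt_flow hb s x).continuousAt.continuousWithinAt)
    (fun s _ => (hasDerivAt_flow hb s x).hasDerivWithinAt) (fun s _ => by simp)
    (fun s _ => (hasDerivAt_flow hb' s y).continuousAt.continuousWithinAt)
    (fun s _ => (hasDerivAt_flow hb' s y).hasDerivWithinAt) (fun s _ => hε _)
    (by simp [flow_zero hb, flow_zero hb']) t ⟨ht, le_rfl⟩
  simpa using h

theorem dist_flow_le (hb : C1Periodic b) {K : NNReal} (hK : LipschitzWith K b) (t : ℝ)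
    (x y : E d) : dist (flow b t x) (flow b t y) ≤ dist x y * Real.exp (K * |t|) := by
  rcases le_total 0 t with ht | ht
  · simpa [gronwallBound_ε0, abs_of_nonneg ht] using
      dist_flow_flow_le hb hb hK (ε := 0) (fun x => by simp) x y ht
  · have h := dist_flow_flow_le hb.neg hb.neg (K := K) hK.neg (ε := 0)
      (fun x => by simp) x y (neg_nonneg.2 ht)
    rw [← flow_neg hb, ← flow_neg hb, neg_neg] at h
    simpa [gronwallBound_ε0, abs_of_nonpos ht] using h

theorem lipschitzWith_flow (hb : C1Periodic b) {K : NNReal} (hK : LipschitzWith K b) (t : ℝ) :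
    LipschitzWith (Real.exp (K * |t|)).toNNReal (flow b t) :=
  LipschitzWith.of_dist_le_mul fun x y => by
    rw [Real.coe_toNNReal _ (Real.exp_pos _).le, mul_comm]
    exact dist_flow_le hb hK t x y

theorem continuous_flow_left (hb : C1Periodic b) (x : E d) : Continuous fun t => flow b t x :=
  continuous_iff_continuousAt.2 fun t => (hasDerivAt_flow hb t x).continuousAt

theorem continuous_flow_right (hb : C1Periodic b) (t : ℝ) : Continuous (flow b t) := by
  obtain ⟨K, hK⟩ := hb.lipschitz
  exact (lipschitzWith_flow hb hK t).continuous

theorem continuous_uncurry_flow (hb : C1Periodic b) :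
    Continuous fun p : ℝ × E d => flow b p.1 p.2 := by
  obtain ⟨M, hM⟩ := hb.periodic.bounded hb.contDiff.continuous
  refine continuous_prod_of_continuous_lipschitzWith (fun p : ℝ × E d => flow b p.1 p.2) M
    (fun t => continuous_flow_right hb t) (fun x => ?_)
  exact lipschitzWith_of_nnnorm_deriv_le (fun t => (hasDerivAt_flow hb t x).differentiableAt)
    fun t => by rw [(hasDerivAt_flow hb t x).deriv]; exact hM _

theorem periodic_comp_flow (hb : C1Periodic b) {F : Type*} {ψ : E d → F} (hψ : Periodic ψ)
    (t : ℝ) : Periodic fun x => ψ (flow b t x) := fun κ x => by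
  simp only [flow_add_intCast hb, hψ κ]

/-! ### Invariant measures and change of time -/

/-- Invariance of a measure under the flow of `b`, tested on continuous periodic functions; no
normalisation of the mass is required. -/
def IsInvariant (b : E d → E d) (ν : Measure (E d)) : Prop :=
  ∀ (t : ℝ) (ψ : E d → ℝ), Continuous ψ → Periodic ψ →
    ∫ y, ψ (flow b t y) ∂ν = ∫ y, ψ y ∂ν

theorem Periodic.mul {f g : E d → ℝ} (hf : Periodic f) (hg : Periodic g) :
    Periodic fun x => f x * g x := fun κ x => by simp only [hf κ x, hg κ x]

theorem Periodic.sub {f g : E d → ℝ} (hf : Periodic f) (hg : Periodic g) :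
    Periodic fun x => f x - g x := fun κ x => by simp only [hf κ x, hg κ x]

theorem Periodic.integrable {F : Type*} [NormedAddCommGroup F] {f : E d → F}
    (hf : Periodic f) (hc : Continuous f) (ν : Measure (E d)) [IsFiniteMeasure ν] :
    Integrable f ν := by
  obtain ⟨C, hC⟩ := hf.bounded hc
  exact Integrable.of_bound hc.aestronglyMeasurable C (ae_of_all _ hC)

/-- An invariant measure annihilates every derivative along the flow. -/
theorem IsInvariant.integral_eq_zero_of_hasDerivAt (hb : C1Periodic b) {ν : Measure (E d)}
    [IsFiniteMeasure ν] (hν : IsInvariant b ν) {u w : E d → ℝ} (hu : Continuous u)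
    (hup : Periodic u) (hw : Continuous w) (hwp : Periodic w)
    (hd : ∀ x t, HasDerivAt (fun s => u (flow b s x)) (w (flow b t x)) t) :
    ∫ y, w y ∂ν = 0 := by
  have hcont : Continuous fun p : ℝ × E d => w (flow b p.1 p.2) :=
    hw.comp (continuous_uncurry_flow hb)
  have h1 : ∀ y, ∫ s in (0 : ℝ)..1, w (flow b s y) = u (flow b 1 y) - u y := fun y => by
    rw [intervalIntegral.integral_eq_sub_of_hasDerivAt (fun s _ => hd y s)
      ((hw.comp (continuous_flow_left hb y)).intervalIntegrable _ _), flow_zero hb]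
  have h2 : ∫ y, (∫ s in (0 : ℝ)..1, w (flow b s y)) ∂ν = 0 := by
    simp_rw [h1]
    rw [integral_sub ((periodic_comp_flow hb hup 1).integrable
      (hu.comp (continuous_flow_right hb 1)) ν) (hup.integrable hu ν), hν 1 u hu hup, sub_self]
  obtain ⟨C, hC⟩ := hwp.bounded hw
  have : IsFiniteMeasure (volume.restrict (Set.uIoc (0 : ℝ) 1)) := ⟨by simp⟩
  have h3 : ∫ s in (0 : ℝ)..1, (∫ y, w (flow b s y) ∂ν) =
      ∫ y, (∫ s in (0 : ℝ)..1, w (flow b s y)) ∂ν :=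
    intervalIntegral_integral_swap (f := fun s y => w (flow b s y))
      (Integrable.of_bound hcont.aestronglyMeasurable C (ae_of_all _ fun _ => hC _))
  rw [h2] at h3
  simpa [hν _ w hw hwp] using h3

/-- If `b' = c • b`, the orbits of `b'` are those of `b`, run with the internal time
`∫₀ˢ c(X'(r,x)) dr`. -/
theorem flow_smul_eq_flow (hb : C1Periodic b) {b' : E d → E d} (hb' : C1Periodic b')
    {c : E d → ℝ} (hc : Continuous c) (hcp : Periodic c) (h : ∀ x, b' x = c x • b x)
    (s : ℝ) (x : E d) :
    flow b' s x = flow b (∫ r in (0 : ℝ)..s, c (flow b' r x)) x := by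
  obtain ⟨K, hK⟩ := hb.lipschitz
  obtain ⟨M, hM⟩ := hcp.bounded hc
  have hτ : ∀ s : ℝ, HasDerivAt (fun s => ∫ r in (0 : ℝ)..s, c (flow b' r x))
      (c (flow b' s x)) s := fun s =>
    (hc.comp (continuous_flow_left hb' x)).integral_hasStrictDerivAt 0 s |>.hasDerivAt
  refine congrFun (f := fun s => flow b' s x)
    (g := fun s => flow b (∫ r in (0 : ℝ)..s, c (flow b' r x)) x)
    (ODE_solution_unique_univ (v := fun s z => c (flow b' s x) • b z) (s := fun _ => Set.univ) 
      (t₀ := 0) (K := M * K) (fun s => ?_) (fun t => ⟨?_, trivial⟩)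
      (fun t => ⟨?_, trivial⟩) ?_) s
  · refine (LipschitzWith.of_dist_le_mul fun y z => ?_).lipschitzOnWith
    rw [dist_smul₀, NNReal.coe_mul, mul_assoc]
    exact mul_le_mul (hM _) (hK.dist_le_mul y z) dist_nonneg M.2
  · rw [← h]
    exact hasDerivAt_flow hb' t x
  · exact (hasDerivAt_flow hb _ x).scomp t (hτ t)
  · simp [flow_zero hb, flow_zero hb']

/-- The integral of `ψ` over an orbit segment of duration `T` is differentiable along the flow,
whatever the regularity of the continuous function `ψ`. -/
theorem hasDerivAt_integral_comp_flow (hb : C1Periodic b) {ψ : E d → ℝ} (hψ : Continuous ψ)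
    (T : ℝ) (x : E d) (t : ℝ) :
    HasDerivAt (fun r => ∫ s in (0 : ℝ)..T, ψ (flow b s (flow b r x)))
      (ψ (flow b T (flow b t x)) - ψ (flow b t x)) t := by
  have hg : Continuous fun s => ψ (flow b s x) := hψ.comp (continuous_flow_left hb x)
  have hI : ∀ a b' : ℝ, IntervalIntegrable (fun s => ψ (flow b s x)) volume a b' :=
    fun a b' => hg.intervalIntegrable a b'
  have heq : (fun r => ∫ s in (0 : ℝ)..T, ψ (flow b s (flow b r x))) =
      fun r => (∫ s in (0 : ℝ)..(T + r), ψ (flow b s x)) - ∫ s in (0 : ℝ)..r, ψ (flow b s x) := by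
    funext r
    rw [intervalIntegral.integral_interval_sub_left (hI _ _) (hI _ _)]
    simp_rw [← flow_add hb]
    rw [intervalIntegral.integral_comp_add_right (fun s => ψ (flow b s x)) r, zero_add]
  rw [heq, ← flow_add hb]
  exact ((hg.integral_hasStrictDerivAt 0 (T + t)).hasDerivAt.comp_const_add T t).sub
    (hg.integral_hasStrictDerivAt 0 t).hasDerivAt

theorem continuous_integral_comp_flow (hb : C1Periodic b) {ψ : E d → ℝ} (hψ : Continuous ψ)
    (T : ℝ) : Continuous fun x => ∫ s in (0 : ℝ)..T, ψ (flow b s x) :=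
  intervalIntegral.continuous_parametric_intervalIntegral_of_continuous'
    (f := fun x s => ψ (flow b s x))
    (hψ.comp ((continuous_uncurry_flow hb).comp continuous_swap)) 0 T

theorem periodic_integral_comp_flow (hb : C1Periodic b) {ψ : E d → ℝ} (hψ : Periodic ψ)
    (T : ℝ) : Periodic fun x => ∫ s in (0 : ℝ)..T, ψ (flow b s x) := fun κ x => by
  simp only [periodic_comp_flow hb hψ _ κ x]

/-- Change of time: if `ν` is invariant for `c • b`, then `c • ν` is invariant for `b`. The
function `c` may vanish. -/
theorem IsInvariant.integral_mul_comp_flow (hb : C1Periodic b) {b' : E d → E d}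
    (hb' : C1Periodic b') {c : E d → ℝ} (hc : Continuous c) (hcp : Periodic c)
    (h : ∀ x, b' x = c x • b x) {ν : Measure (E d)} [IsFiniteMeasure ν] (hν : IsInvariant b' ν)
    (T : ℝ) {ψ : E d → ℝ} (hψ : Continuous ψ) (hψp : Periodic ψ) :
    ∫ y, c y * ψ (flow b T y) ∂ν = ∫ y, c y * ψ y ∂ν := by
  have hψT := hψ.comp (continuous_flow_right hb T)
  have hψTp := periodic_comp_flow hb hψp T
  -- `u x = ∫₀ᵀ ψ(X(s,x)) ds` has derivative `ψ(X(T,x)) - ψ(x)` along the orbits of `b`, hence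
  -- `c` times this along those of `b'`, by reparametrisation.
  have h0 : ∫ y, c y * (ψ (flow b T y) - ψ y) ∂ν = 0 := by
    refine hν.integral_eq_zero_of_hasDerivAt hb' (continuous_integral_comp_flow hb hψ T)
      (periodic_integral_comp_flow hb hψp T) (hc.mul (hψT.sub hψ))
      (hcp.mul (hψTp.sub hψp)) (fun x t => ?_)
    have hτ : HasDerivAt (fun s => ∫ r in (0 : ℝ)..s, c (flow b' r x)) (c (flow b' t x)) t :=
      ((hc.comp (continuous_flow_left hb' x)).integral_hasStrictDerivAt 0 t).hasDerivAt
    have key := (hasDerivAt_integral_comp_flow hb hψ T x _).comp t hτ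
    rw [← flow_smul_eq_flow hb hb' hc hcp h, mul_comm] at key
    refine key.congr_of_eventuallyEq (Eventually.of_forall fun s => ?_)
    simp only [Function.comp, ← flow_smul_eq_flow hb hb' hc hcp h]
  have e : ∀ y, c y * (ψ (flow b T y) - ψ y) = c y * ψ (flow b T y) - c y * ψ y :=
    fun y => mul_sub _ _ _
  simp_rw [e] at h0
  rwa [integral_sub, sub_eq_zero] at h0
  · exact (hcp.mul hψTp).integrable (hc.mul hψT) ν
  · exact (hcp.mul hψp).integrable (hc.mul hψ) ν

/-! ### Divergence free fields and Lebesgue measure -/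

theorem cell_eq_fundamentalDomain :
    cell d = ZSpan.fundamentalDomain (EuclideanSpace.basisFun (Fin d) ℝ).toBasis := by
  ext x
  simp [cell, ZSpan.mem_fundamentalDomain]

theorem measurableSet_cell : MeasurableSet (cell d) := by
  rw [cell_eq_fundamentalDomain]
  exact ZSpan.fundamentalDomain_measurableSet _

theorem volume_cell_ne_zero : volume (cell d) ≠ 0 := by
  rw [cell_eq_fundamentalDomain]
  exact ZSpan.measure_fundamentalDomain_ne_zero _

instance isFiniteMeasure_restrict_cell :
    IsFiniteMeasure ((volume : Measure (E d)).restrict (cell d)) := by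
  refine isFiniteMeasure_restrict.2 ?_
  rw [cell_eq_fundamentalDomain]
  exact (ZSpan.fundamentalDomain_isBounded _).measure_lt_top.ne

theorem Periodic.add_mem_span {F : Type*} {f : E d → F} (hf : Periodic f) {v : E d}
    (hv : v ∈ Submodule.span ℤ (Set.range (EuclideanSpace.basisFun (Fin d) ℝ).toBasis))
    (x : E d) : f (v + x) = f x := by
  rw [Module.Basis.mem_span_iff_repr_mem] at hv
  choose κ hκ using hv
  have : v = WithLp.toLp 2 (fun i => (κ i : ℝ)) := by
    ext i
    simpa using (hκ i).symm
  rw [this, add_comm, hf]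

open scoped Pointwise in
/-- The integral of a periodic function over a translate of the cell is its integral over the
cell. -/
theorem Periodic.setIntegral_cell_add {f : E d → ℝ} (hf : Periodic f) (v : E d) :
    ∫ x in cell d, f (x + v) = ∫ x in cell d, f x := by
  have : Countable (Submodule.span ℤ
      (Set.range (EuclideanSpace.basisFun (Fin d) ℝ).toBasis)).toAddSubgroup :=
    inferInstanceAs (Countable (Submodule.span ℤ
      (Set.range (EuclideanSpace.basisFun (Fin d) ℝ).toBasis)))
  have h1 := ZSpan.isAddFundamentalDomain' (EuclideanSpace.basisFun (Fin d) ℝ).toBasis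
    (volume : Measure (E d))
  rw [← cell_eq_fundamentalDomain] at h1
  have h2 := h1.vadd_of_comm v
  have h3 := h1.setIntegral_eq h2 (f := f) (fun g x => hf.add_mem_span g.2 x)
  have h4 := (measurePreserving_add_right (volume : Measure (E d)) v).setIntegral_preimage_emb
    (measurableEmbedding_addRight v) f (v +ᵥ cell d)
  rw [h3, ← h4]
  congr 2
  ext x
  simp [Set.mem_vadd_set_iff_neg_vadd_mem]

/-- Integration by parts over the cell: the boundary terms cancel by periodicity. -/
theorem setIntegral_cell_lineDeriv_mul {u g : E d → ℝ} {C D : NNReal} (hu : LipschitzWith C u)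
    (hup : Periodic u) (hg : LipschitzWith D g) (hgp : Periodic g) (v : E d) :
    ∫ x in cell d, lineDeriv ℝ u x v * g x = ∫ x in cell d, lineDeriv ℝ g x (-v) * u x := by
  have key : ∀ {f h : E d → ℝ} {C : NNReal}, LipschitzWith C f → Continuous h → Periodic h →
      ∀ v : E d, Tendsto (fun t : ℝ => ∫ x in cell d, (t⁻¹ * (f (x + t • v) - f x)) * h x)
        (𝓝[>] 0) (𝓝 (∫ x in cell d, lineDeriv ℝ f x v * h x)) := by
    intro f h C hf hh hhp v
    have h1 : Integrable ((cell d).indicator h) volume :=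
      (integrable_indicator_iff measurableSet_cell).2 (hhp.integrable hh _)
    have h2 := hf.integral_inv_smul_sub_mul_tendsto_integral_lineDeriv_mul h1 v
    have e : ∀ q : E d → ℝ, ∫ x, q x * (cell d).indicator h x = ∫ x in cell d, q x * h x := by
      intro q
      rw [← integral_indicator measurableSet_cell]
      simp only [Set.indicator_mul_right]
    simpa only [e, smul_eq_mul] using h2
  -- The difference quotients along `v` and `-v` have equal integrals at every scale `t`.
  refine tendsto_nhds_unique (key hu hg.continuous hgp v) ?_
  refine (key hg hu.continuous hup (-v)).congr fun t => ?_
  have cI : ∀ {f : E d → ℝ}, Continuous f → Periodic f → IntegrableOn f (cell d) :=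
    fun hc hp => hp.integrable hc _
  have hsh : ∀ {f : E d → ℝ}, Periodic f → ∀ z, Periodic fun x => f (x + z) :=
    fun hp z κ x => by simp only [add_right_comm x _ z, hp κ]
  have ca : ∀ z : E d, Continuous fun x : E d => x + z := fun z =>
    continuous_id.add continuous_const
  have e1 : ∫ x in cell d, g (x + t • -v) * u x = ∫ x in cell d, g x * u (x + t • v) := by
    rw [← ((hsh hgp (t • -v)).mul hup).setIntegral_cell_add (t • v)]
    simp
  have e2 : ∀ {f h : E d → ℝ} (w : E d), Continuous f → Periodic f → Continuous h → Periodic h →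
      ∫ x in cell d, (t⁻¹ * (f (x + t • w) - f x)) * h x =
        t⁻¹ * (∫ x in cell d, f (x + t • w) * h x) - t⁻¹ * ∫ x in cell d, f x * h x := by
    intro f h w hf hfp hh hhp
    have i1 : IntegrableOn (fun x => f (x + t • w) * h x) (cell d) :=
      cI ((hf.comp (ca _)).mul hh) ((hsh hfp _).mul hhp)
    have i2 : IntegrableOn (fun x => f x * h x) (cell d) := cI (hf.mul hh) (hfp.mul hhp)
    rw [← mul_sub, ← integral_sub i1 i2, ← integral_const_mul]
    exact integral_congr_ae (ae_of_all _ fun x => by ring)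
  rw [e2 _ hg.continuous hgp hu.continuous hup, e2 _ hu.continuous hup hg.continuous hgp, e1]
  simp only [mul_comm]

theorem C1Periodic.apply {V : E d → E d} (hV : C1Periodic V) (i : Fin d) :
    C1Periodic fun x => V x i :=
  ⟨(contDiff_piLp_apply (p := 2)).comp hV.contDiff, fun κ x => by simp only [hV.periodic κ x]⟩

/-- A divergence free field is orthogonal, in mean over the cell, to the gradient of a Lipschitz
periodic function, which exists almost everywhere by Rademacher's theorem. -/
theorem setIntegral_cell_fderiv_eq_zero {V : E d → E d} (hV : C1Periodic V)
    (hdiv : ∀ x, divergence V x = 0) {u : E d → ℝ} {C : NNReal} (hu : LipschitzWith C u)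
    (hup : Periodic u) : ∫ x in cell d, fderiv ℝ u x (V x) = 0 := by
  have hVd : Differentiable ℝ V := hV.contDiff.differentiable one_ne_zero
  have h1 : ∀ᵐ x ∂(volume.restrict (cell d)), fderiv ℝ u x (V x) =
      ∑ i, lineDeriv ℝ u x (EuclideanSpace.single i 1) * V x i := by
    filter_upwards [ae_restrict_of_ae hu.ae_differentiableAt] with x hx
    have hx2 : V x = ∑ i, V x i • EuclideanSpace.single i (1 : ℝ) := by
      simpa using ((EuclideanSpace.basisFun (Fin d) ℝ).sum_repr (V x)).symm
    conv_lhs => rw [hx2]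
    simp only [map_sum, map_smul, smul_eq_mul, hx.lineDeriv_eq_fderiv, mul_comm]
  rw [integral_congr_ae h1, integral_finsetSum]
  · have h2 : ∀ i, ∫ x in cell d, lineDeriv ℝ u x (EuclideanSpace.single i 1) * V x i =
        ∫ x in cell d, -(fderiv ℝ V x (EuclideanSpace.single i 1)) i * u x := by
      intro i
      obtain ⟨D, hD⟩ := (hV.apply i).lipschitz
      rw [setIntegral_cell_lineDeriv_mul hu hup hD (hV.apply i).periodic]
      refine integral_congr_ae (ae_of_all _ fun x => ?_)
      have hd : HasFDerivAt (fun y => V y i) ((EuclideanSpace.proj i).comp (fderiv ℝ V x)) x :=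
        (EuclideanSpace.proj (𝕜 := ℝ) i).hasFDerivAt.comp x (hVd x).hasFDerivAt
      simp [hd.differentiableAt.lineDeriv_eq_fderiv, hd.fderiv]
    have hcd : ∀ i, Continuous fun x => (fderiv ℝ V x (EuclideanSpace.single i 1)) i := fun i =>
      (EuclideanSpace.proj (𝕜 := ℝ) i).continuous.comp
        ((hV.contDiff.continuous_fderiv one_ne_zero).clm_apply continuous_const)
    have hpd : Periodic (fderiv ℝ V) := by
      intro κ x
      rw [← fderiv_comp_add_right, funext (hV.periodic κ)]
    simp_rw [h2]
    rw [← integral_finsetSum]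
    · simp_rw [← Finset.sum_mul, Finset.sum_neg_distrib]
      refine (integral_congr_ae (ae_of_all _ fun x => ?_)).trans (integral_zero _ _)
      have := hdiv x
      rw [divergence] at this
      simp [this]
    · intro i _
      have hp : Periodic fun x => -(fderiv ℝ V x (EuclideanSpace.single i 1)) i := fun κ x => by
        simp only [hpd κ x]
      exact (hp.mul hup).integrable ((hcd i).neg.mul hu.continuous) _
  · intro i _
    obtain ⟨M, hM⟩ := (hV.apply i).periodic.bounded (hV.apply i).contDiff.continuous
    refine Integrable.of_bound ((aestronglyMeasurable_lineDeriv hu.continuous _).mul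
      (hV.apply i).contDiff.continuous.aestronglyMeasurable)
      (C * ‖EuclideanSpace.single i (1 : ℝ)‖ * M) (ae_of_all _ fun x => ?_)
    rw [norm_mul]
    exact mul_le_mul (norm_lineDeriv_le_of_lipschitz ℝ hu) (hM x) (norm_nonneg _) (by positivity)

theorem lipschitzWith_integral_comp_flow {b : E d → E d} (hb : C1Periodic b) {ψ : E d → ℝ}
    {L : NNReal} (hψ : LipschitzWith L ψ) (T : ℝ) :
    ∃ C : NNReal, LipschitzWith C fun x => ∫ s in (0 : ℝ)..T, ψ (flow b s x) := by
  obtain ⟨K, hK⟩ := hb.lipschitz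
  refine ⟨L * (Real.exp (K * |T|)).toNNReal * |T|.toNNReal,
    LipschitzWith.of_dist_le_mul fun x y => ?_⟩
  have hI : ∀ z, IntervalIntegrable (fun s => ψ (flow b s z)) volume 0 T := fun z =>
    (hψ.continuous.comp (continuous_flow_left hb z)).intervalIntegrable _ _
  rw [dist_eq_norm, ← intervalIntegral.integral_sub (hI x) (hI y)]
  refine (intervalIntegral.norm_integral_le_of_norm_le_const
    (C := L * (dist x y * Real.exp (K * |T|))) fun s hs => ?_).trans (le_of_eq ?_)
  · rw [← dist_eq_norm]
    refine (hψ.dist_le_mul _ _).trans (mul_le_mul_of_nonneg_left ?_ L.2)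
    refine (dist_flow_le hb hK s x y).trans ?_
    have hsT : |s| ≤ |T| := by
      simpa using Set.abs_sub_left_of_mem_uIcc (Set.uIoc_subset_uIcc hs)
    gcongr
  · simp only [NNReal.coe_mul, Real.coe_toNNReal _ (Real.exp_pos _).le,
      Real.coe_toNNReal _ (abs_nonneg T), sub_zero]
    ring

/-- A continuous periodic function is a bounded pointwise limit of Lipschitz periodic functions,
its inf-convolutions with the multiples of the distance. -/
theorem Periodic.exists_lipschitz_tendsto {ψ : E d → ℝ} (hψ : Periodic ψ) (hc : Continuous ψ) :
    ∃ (φ : ℕ → E d → ℝ) (M : ℝ), (∀ k, ∃ L : NNReal, LipschitzWith L (φ k)) ∧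
      (∀ k, Periodic (φ k)) ∧ (∀ k x, ‖φ k x‖ ≤ M) ∧
      ∀ x, Tendsto (fun k => φ k x) atTop (𝓝 (ψ x)) := by
  obtain ⟨M, hM⟩ := hψ.bounded hc
  have hM' : ∀ x, -(M : ℝ) ≤ ψ x ∧ ψ x ≤ M := fun x => abs_le.1 (hM x)
  have hbdd : ∀ (k : ℕ) x, BddBelow (Set.range fun y => ψ y + k * dist x y) := by
    rintro k x
    refine ⟨-M, ?_⟩
    rintro _ ⟨y, rfl⟩
    have := (hM' y).1
    have : (0 : ℝ) ≤ k * dist x y := by positivity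
    simp only
    linarith
  have hle : ∀ (k : ℕ) x, ⨅ y, (ψ y + k * dist x y) ≤ ψ x := fun k x => by
    simpa using ciInf_le (hbdd k x) x
  refine ⟨fun k x => ⨅ y, (ψ y + k * dist x y), M, fun k => ⟨k, ?_⟩, fun k κ x => ?_,
    fun k x => abs_le.2 ⟨?_, ?_⟩, fun x => ?_⟩
  · refine LipschitzWith.of_le_add_mul _ fun x y => ?_
    rw [← sub_le_iff_le_add]
    refine le_ciInf fun z => ?_
    have h1 := ciInf_le (hbdd k x) z
    have h2 : (k : ℝ) * dist x z ≤ k * (dist x y + dist y z) :=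
      mul_le_mul_of_nonneg_left (dist_triangle x y z) k.cast_nonneg
    simp only [NNReal.coe_natCast] at h1 ⊢
    linarith
  · simp only
    rw [← (Equiv.addRight (WithLp.toLp 2 (fun i => (κ i : ℝ)) : E d)).iInf_comp]
    simp [hψ κ]
  · refine le_ciInf fun y => ?_
    have := (hM' y).1
    have : (0 : ℝ) ≤ k * dist x y := by positivity
    linarith
  · exact (hle k x).trans (hM' x).2
  · refine Metric.tendsto_atTop.2 fun ε hε => ?_
    obtain ⟨δ, hδ, h⟩ := Metric.continuous_iff.1 hc x (ε / 2) (half_pos hε)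
    obtain ⟨N, hN⟩ := exists_nat_ge (2 * M / δ)
    refine ⟨N, fun k hk => ?_⟩
    have hk' : 2 * M ≤ k * δ := by
      rw [← div_le_iff₀ hδ]
      exact hN.trans (by exact_mod_cast hk)
    have hlow : ψ x - ε / 2 ≤ ⨅ y, (ψ y + k * dist x y) := by
      refine le_ciInf fun y => ?_
      rcases lt_or_ge (dist y x) δ with hy | hy
      · have h3 := (abs_lt.1 (h y hy)).1
        have : (0 : ℝ) ≤ k * dist x y := by positivity
        linarith
      · have h4 : (k : ℝ) * δ ≤ k * dist x y := by
          rw [dist_comm x y]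
          exact mul_le_mul_of_nonneg_left hy k.cast_nonneg
        linarith [(hM' x).2, (hM' y).1]
    rw [Real.dist_eq, abs_lt]
    constructor <;> linarith [hle k x]

/-- **Liouville's theorem** on the torus: the flow of a divergence free vector field preserves the
Lebesgue measure. -/
theorem isInvariant_restrict_cell {V : E d → E d} (hV : C1Periodic V)
    (hdiv : ∀ x, divergence V x = 0) : IsInvariant V (volume.restrict (cell d)) := by
  have hlip : ∀ (T : ℝ) (ψ : E d → ℝ) (L : NNReal), LipschitzWith L ψ → Periodic ψ →
      ∫ y in cell d, ψ (flow V T y) = ∫ y in cell d, ψ y := by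
    intro T ψ L hψ hψp
    -- `u x = ∫₀ᵀ ψ(X(s,x)) ds` has `ψ(X(T,x)) - ψ(x)` as derivative along the flow; where `u` is
    -- differentiable this is also its gradient applied to `V`.
    obtain ⟨C, hC⟩ := lipschitzWith_integral_comp_flow hV hψ T
    have h0 := setIntegral_cell_fderiv_eq_zero hV hdiv hC (periodic_integral_comp_flow hV hψp T)
    have h1 : ∀ᵐ x ∂(volume.restrict (cell d)),
        fderiv ℝ (fun x => ∫ s in (0 : ℝ)..T, ψ (flow V s x)) x (V x) =
          ψ (flow V T x) - ψ x := by
      filter_upwards [ae_restrict_of_ae hC.ae_differentiableAt] with x hx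
      have h2 := hasDerivAt_integral_comp_flow hV hψ.continuous T x 0
      have h3 : HasDerivAt (fun r => flow V r x) (V x) 0 := by
        simpa [flow_zero hV] using hasDerivAt_flow hV 0 x
      have h4 : HasFDerivAt (fun x => ∫ s in (0 : ℝ)..T, ψ (flow V s x))
          (fderiv ℝ (fun x => ∫ s in (0 : ℝ)..T, ψ (flow V s x)) x) (flow V 0 x) := by
        rw [flow_zero hV]
        exact hx.hasFDerivAt
      rw [flow_zero hV] at h2
      have h5 := h4.comp_hasDerivAt 0 h3
      exact h5.unique h2
    rw [integral_congr_ae h1, integral_sub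
      ((periodic_comp_flow hV hψp T).integrable (hψ.continuous.comp (continuous_flow_right hV T)) _)
      (hψp.integrable hψ.continuous _)] at h0
    exact sub_eq_zero.1 h0
  intro T ψ hψ hψp
  obtain ⟨φ, M, hφL, hφp, hφM, hφ⟩ := hψp.exists_lipschitz_tendsto hψ
  have hφc : ∀ k, Continuous (φ k) := fun k => (hφL k).choose_spec.continuous
  have h1 : Tendsto (fun k => ∫ y in cell d, φ k (flow V T y)) atTop
      (𝓝 (∫ y in cell d, ψ (flow V T y))) :=
    tendsto_integral_of_dominated_convergence (fun _ => M)
      (fun k => ((hφc k).comp (continuous_flow_right hV T)).aestronglyMeasurable)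
      (integrable_const _) (fun k => ae_of_all _ fun x => hφM k _) (ae_of_all _ fun x => hφ _)
  have h2 : Tendsto (fun k => ∫ y in cell d, φ k y) atTop (𝓝 (∫ y in cell d, ψ y)) :=
    tendsto_integral_of_dominated_convergence (fun _ => M)
      (fun k => (hφc k).aestronglyMeasurable)
      (integrable_const _) (fun k => ae_of_all _ fun x => hφM k _) (ae_of_all _ fun x => hφ _)
  refine tendsto_nhds_unique h1 (h2.congr fun k => ?_)
  obtain ⟨L, hL⟩ := hφL k
  exact (hlip T (φ k) L hL (hφp k)).symm

/-! ### Constructions in the rotation set -/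

/-- Rotation vectors from unnormalised invariant densities: `c • μ` need not be a probability
measure, and `c` is only integrable, so that unbounded densities are allowed. -/
theorem smul_integral_mem_hermanSet {μ : Measure (E d)} (hμ : μ (cell d)ᶜ = 0) {c : E d → ℝ}
    (hc0 : ∀ x, 0 ≤ c x) (hc : Integrable c μ) (hm : 0 < ∫ y, c y ∂μ)
    (hinv : ∀ (t : ℝ) (ψ : E d → ℝ), Continuous ψ → Periodic ψ →
      ∫ y, c y * ψ (flow b t y) ∂μ = ∫ y, c y * ψ y ∂μ) :
    (∫ y, c y ∂μ)⁻¹ • ∫ y, c y • b y ∂μ ∈ hermanSet b := by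
  set m := ∫ y, c y ∂μ
  have h0 : ∀ y, 0 ≤ m⁻¹ * c y := fun y => mul_nonneg (inv_nonneg.2 hm.le) (hc0 y)
  have hint : ∀ {F : Type} [NormedAddCommGroup F] [NormedSpace ℝ F] (f : E d → F),
      ∫ y, f y ∂(μ.withDensity fun y => ENNReal.ofReal (m⁻¹ * c y)) =
        m⁻¹ • ∫ y, c y • f y ∂μ := by
    intro F _ _ f
    rw [integral_withDensity_eq_integral_toReal_smul₀
      (hc.aestronglyMeasurable.aemeasurable.const_mul _).ennreal_ofReal
      (ae_of_all _ fun _ => ENNReal.ofReal_lt_top), ← integral_smul]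
    simp only [ENNReal.toReal_ofReal (h0 _), mul_smul]
  refine ⟨μ.withDensity fun y => ENNReal.ofReal (m⁻¹ * c y), ⟨⟨?_⟩, ?_, fun t ψ hψ hψp => ?_⟩,
    hint b⟩
  · rw [withDensity_apply _ MeasurableSet.univ, Measure.restrict_univ,
      ← ofReal_integral_eq_lintegral_ofReal (hc.const_mul _) (ae_of_all _ h0), integral_const_mul,
      inv_mul_cancel₀ hm.ne', ENNReal.ofReal_one]
  · exact withDensity_absolutelyContinuous _ _ hμ
  · simp only [hint, smul_eq_mul, hinv t ψ hψ hψp]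

theorem convex_hermanSet (hb : C1Periodic b) : Convex ℝ (hermanSet b) := by
  rintro _ ⟨μ, ⟨hμ, hμc, hμi⟩, rfl⟩ _ ⟨ν, ⟨hν, hνc, hνi⟩, rfl⟩ p q hp hq hpq
  have hint : ∀ {F : Type} [NormedAddCommGroup F] [NormedSpace ℝ F] {f : E d → F},
      Continuous f → Periodic f →
      ∫ y, f y ∂(ENNReal.ofReal p • μ + ENNReal.ofReal q • ν) =
        p • ∫ y, f y ∂μ + q • ∫ y, f y ∂ν := by
    intro F _ _ f hf hfp
    rw [integral_add_measure ((hfp.integrable hf μ).smul_measure ENNReal.ofReal_ne_top)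
      ((hfp.integrable hf ν).smul_measure ENNReal.ofReal_ne_top), integral_smul_measure,
      integral_smul_measure, ENNReal.toReal_ofReal hp, ENNReal.toReal_ofReal hq]
  refine ⟨ENNReal.ofReal p • μ + ENNReal.ofReal q • ν, ⟨⟨?_⟩, ?_, fun t ψ hψ hψp => ?_⟩,
    hint hb.contDiff.continuous hb.periodic⟩
  · simp [← ENNReal.ofReal_add hp hq, hpq]
  · simp [hμc, hνc]
  · have h := hint (hψ.comp (continuous_flow_right hb t)) (periodic_comp_flow hb hψp t)
    simp only [Function.comp_apply, hμi t ψ hψ hψp, hνi t ψ hψ hψp] at h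
    rw [h, hint hψ hψp]

/-- The representative in the cell of the class of `x` modulo `ℤ^d`. -/
noncomputable def cellFract (x : E d) : E d := WithLp.toLp 2 fun i => Int.fract (x i)

theorem cellFract_mem_cell (x : E d) : cellFract x ∈ cell d :=
  fun _ => ⟨Int.fract_nonneg _, Int.fract_lt_one _⟩

theorem Periodic.comp_cellFract {F : Type*} {f : E d → F} (hf : Periodic f) (x : E d) :
    f (cellFract x) = f x := by
  rw [← hf (fun i => -⌊x i⌋) x]
  congr 1
  ext i
  simp [cellFract, Int.fract, sub_eq_add_neg]

theorem measurable_cellFract : Measurable (cellFract : E d → E d) :=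
  (WithLp.measurable_toLp 2 _).comp (measurable_pi_lambda _ fun i =>
    measurable_fract.comp ((EuclideanSpace.proj (𝕜 := ℝ) i).continuous.measurable))

theorem zero_mem_hermanSet (hb : C1Periodic b) {x : E d} (hx : b x = 0) :
    0 ∈ hermanSet b := by
  have h1 : b (cellFract x) = 0 := by rw [hb.periodic.comp_cellFract, hx]
  refine ⟨Measure.dirac (cellFract x), ⟨inferInstance, ?_, fun t ψ _ _ => ?_⟩, ?_⟩
  · rw [Measure.dirac_apply' _ measurableSet_cell.compl]
    simp [cellFract_mem_cell]
  · simp [flow_eq_self hb h1]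
  · simp [h1]

/-! ### Harmonic means and the rotation set of a degenerate field -/

theorem C1Periodic.smul {r : E d → ℝ} {Φ : E d → E d} (hr : C1Periodic r) (hΦ : C1Periodic Φ) :
    C1Periodic fun x => r x • Φ x :=
  ⟨hr.contDiff.smul hΦ.contDiff, fun κ x => by simp only [hr.periodic κ x, hΦ.periodic κ x]⟩

theorem Periodic.div {f g : E d → ℝ} (hf : Periodic f) (hg : Periodic g) :
    Periodic fun x => f x / g x := fun κ x => by simp only [hf κ x, hg κ x]

theorem C1Periodic.continuous {F : Type*} [NormedAddCommGroup F] [NormedSpace ℝ F] {f : E d → F}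
    (hf : C1Periodic f) : Continuous f := hf.contDiff.continuous

theorem continuous_div_of_pos {f r : E d → ℝ} (hf : C1Periodic f) (hr : C1Periodic r)
    (hr0 : ∀ x, 0 < r x) : Continuous fun x => f x / r x :=
  hf.continuous.div hr.continuous fun x => (hr0 x).ne'

theorem setIntegral_div_pos {σ r : E d → ℝ} (hσ : C1Periodic σ) (hσ0 : ∀ x, 0 < σ x)
    (hr : C1Periodic r) (hr0 : ∀ x, 0 < r x) : 0 < ∫ y in cell d, σ y / r y := by
  have h0 : ∀ x, 0 < σ x / r x := fun x => div_pos (hσ0 x) (hr0 x)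
  rw [integral_pos_iff_support_of_nonneg (fun x => (h0 x).le)
    ((hσ.periodic.div hr.periodic).integrable (continuous_div_of_pos hσ hr hr0) _)]
  have : (Function.support fun y => σ y / r y) = Set.univ :=
    Set.eq_univ_of_forall fun x => (h0 x).ne'
  rw [this, Measure.restrict_apply_univ]
  exact pos_iff_ne_zero.2 volume_cell_ne_zero

/-- When `σ • Φ` is divergence free, `σ / r` is an invariant density for `r • Φ`, and it produces
an explicit rotation vector. -/
theorem smul_setIntegral_mem_hermanSet {σ r : E d → ℝ} {Φ : E d → E d} (hΦ : C1Periodic Φ)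
    (hσ : C1Periodic σ) (hσ0 : ∀ x, 0 < σ x)
    (hσΦ : ∀ x, divergence (fun y => σ y • Φ y) x = 0) (hr : C1Periodic r) (hr0 : ∀ x, 0 < r x) :
    (∫ y in cell d, σ y / r y)⁻¹ • ∫ y in cell d, σ y • Φ y ∈
      hermanSet fun x => r x • Φ x := by
  have hc := continuous_div_of_pos hσ hr hr0
  have hcp := hσ.periodic.div hr.periodic
  have e : ∀ x, σ x • Φ x = (σ x / r x) • (r x • Φ x) := fun x => by
    rw [smul_smul, div_mul_cancel₀ _ (hr0 x).ne']
  have h := smul_integral_mem_hermanSet (b := fun x => r x • Φ x)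
    (μ := volume.restrict (cell d))
    (Measure.restrict_apply_eq_zero' measurableSet_cell |>.2 (by simp))
    (fun x => (div_pos (hσ0 x) (hr0 x)).le) (hcp.integrable hc _)
    (setIntegral_div_pos hσ hσ0 hr hr0) (fun t ψ hψ hψp =>
      (isInvariant_restrict_cell (hσ.smul hΦ) hσΦ).integral_mul_comp_flow (hr.smul hΦ)
        (hσ.smul hΦ) hc hcp e t hψ hψp)
  simpa only [← e] using h

/-- The rotation vector of an invariant measure `μ` of the degenerate field `ρ • Φ` is a multiple
of the only rotation vector of `r • Φ`: the measure `(ρ / r) • μ` is invariant for `r • Φ`. -/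
theorem integral_eq_smul_of_hermanSet_eq_singleton {ρ r : E d → ℝ} {Φ : E d → E d}
    (hΦ : C1Periodic Φ) (hρ : C1Periodic ρ) (hρ0 : ∀ x, 0 ≤ ρ x) (hr : C1Periodic r)
    (hr0 : ∀ x, 0 < r x) {ζ : E d} (hζ : hermanSet (fun x => r x • Φ x) = {ζ})
    {μ : Measure (E d)} (hμ : μ ∈ invariantMeasures fun x => ρ x • Φ x) :
    ∫ y, ρ y • Φ y ∂μ = (∫ y, ρ y / r y ∂μ) • ζ := by
  obtain ⟨hμ1, hμc, hμi⟩ := hμ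
  have hc := continuous_div_of_pos hρ hr hr0
  have hcp := hρ.periodic.div hr.periodic
  have hc0 : ∀ x, 0 ≤ ρ x / r x := fun x => div_nonneg (hρ0 x) (hr0 x).le
  have e : ∀ x, ρ x • Φ x = (ρ x / r x) • (r x • Φ x) := fun x => by
    rw [smul_smul, div_mul_cancel₀ _ (hr0 x).ne']
  have hinv : IsInvariant (fun x => ρ x • Φ x) μ := hμi
  rcases (integral_nonneg hc0 : 0 ≤ ∫ y, ρ y / r y ∂μ).eq_or_lt' with h0 | h0
  · have h1 := (integral_eq_zero_iff_of_nonneg hc0 (hcp.integrable hc μ)).1 h0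
    rw [h0, zero_smul]
    refine integral_eq_zero_of_ae ?_
    filter_upwards [h1] with x hx
    simp only [Pi.zero_apply] at hx
    rw [e, hx, zero_smul, Pi.zero_apply]
  · have h1 := smul_integral_mem_hermanSet (b := fun x => r x • Φ x) hμc hc0
      (hcp.integrable hc μ) h0 (fun t ψ hψ hψp =>
        hinv.integral_mul_comp_flow (hr.smul hΦ) (hρ.smul hΦ) hc hcp e t hψ hψp)
    rw [hζ, Set.mem_singleton_iff] at h1
    simp only [← e] at h1
    rw [← h1, smul_smul, mul_inv_cancel₀ h0.ne', one_smul]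

/-- Convergence of the harmonic means, by Fatou's lemma; the limit may be `0`. -/
theorem tendsto_harmonicMean {a : E d → ℝ} {as : ℕ → E d → ℝ} (has : ∀ n, Measurable (as n))
    (hle : ∀ n x, a x ≤ as n x) (hlim : ∀ x, Tendsto (fun n => as n x) atTop (𝓝 (a x))) :
    Tendsto (fun n => harmonicMean (as n)) atTop (𝓝 (harmonicMean a)) := by
  refine Tendsto.inv (tendsto_of_le_liminf_of_limsup_le ?_ ?_)
  · refine le_trans (le_of_eq ?_) (lintegral_liminf_le fun n => (has n).ennreal_ofReal.inv)
    refine lintegral_congr fun x => ?_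
    exact (ENNReal.tendsto_ofReal (hlim x)).inv.liminf_eq.symm
  · refine limsup_le_of_le (h := Eventually.of_forall fun n => lintegral_mono fun x => ?_)
    exact ENNReal.inv_le_inv.2 (ENNReal.ofReal_le_ofReal (hle n x))

theorem ofReal_div_inv {x y : ℝ} (hx : 0 < x) (hy : 0 < y) :
    (ENNReal.ofReal (x / y))⁻¹ = ENNReal.ofReal (y / x) := by
  rw [← ENNReal.ofReal_inv_of_pos (div_pos hx hy), inv_div]

theorem harmonicMean_toReal_of_ae_pos {σ r : E d → ℝ} (hσ : C1Periodic σ)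
    (hσ0 : ∀ x, 0 < σ x) (hr : C1Periodic r) (hr0 : ∀ᵐ x ∂(volume.restrict (cell d)), 0 < r x) :
    (harmonicMean fun y => r y / σ y).toReal = (∫ y in cell d, σ y / r y)⁻¹ := by
  rw [harmonicMean, ENNReal.toReal_inv, integral_eq_lintegral_of_nonneg_ae]
  · congr 2
    refine lintegral_congr_ae ?_
    filter_upwards [hr0] with x hx using ofReal_div_inv hx (hσ0 x)
  · filter_upwards [hr0] with x hx using (div_pos (hσ0 x) hx).le
  · exact (hσ.continuous.measurable.div hr.continuous.measurable).aestronglyMeasurable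

theorem harmonicMean_ne_top {σ r : E d → ℝ} (hσ : C1Periodic σ) (hr : C1Periodic r) :
    (harmonicMean fun y => r y / σ y) ≠ ⊤ := by
  rw [harmonicMean, ENNReal.inv_ne_top]
  intro h
  have hmeas : Measurable fun y => (ENNReal.ofReal (r y / σ y))⁻¹ :=
    (hr.continuous.measurable.div hσ.continuous.measurable).ennreal_ofReal.inv
  rw [lintegral_eq_zero_iff hmeas] at h
  have hF : ∀ᵐ x ∂(volume.restrict (cell d)), False := by
    filter_upwards [h] with x hx
    exact ENNReal.inv_ne_zero.2 ENNReal.ofReal_ne_top hx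
  rw [eventually_false_iff_eq_bot, ae_eq_bot, Measure.restrict_eq_zero] at hF
  exact volume_cell_ne_zero hF

/-- The flow depends continuously on the vector field. -/
theorem tendsto_flow {b : E d → E d} {bs : ℕ → E d → E d} (hb : C1Periodic b)
    (hbs : ∀ n, C1Periodic (bs n)) (hlim : TendstoUniformly bs b atTop) {t : ℝ} (ht : 0 ≤ t)
    (x : E d) : Tendsto (fun n => flow (bs n) t x) atTop (𝓝 (flow b t x)) := by
  obtain ⟨K, hK⟩ := hb.lipschitz
  refine Metric.tendsto_nhds.2 fun δ hδ => ?_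
  have h1 : ∀ᶠ ε in 𝓝 (0 : ℝ), gronwallBound 0 K ε t < δ := by
    refine (gronwallBound_continuous_ε 0 K t).continuousAt.eventually_lt continuousAt_const ?_
    rwa [gronwallBound_ε0_δ0]
  obtain ⟨ε, hε, hε0⟩ := ((h1.filter_mono nhdsWithin_le_nhds).and
    (self_mem_nhdsWithin (a := (0 : ℝ)) (s := Set.Ioi 0))).exists
  filter_upwards [Metric.tendstoUniformly_iff.1 hlim ε hε0] with n hn
  have h2 := dist_flow_flow_le hb (hbs n) hK (ε := ε)
    (fun y => by rw [dist_comm]; exact (hn y).le) x x ht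
  rw [dist_self] at h2
  rw [dist_comm]
  exact h2.trans_lt hε

theorem tendstoUniformly_smul {ρ : E d → ℝ} {ρs : ℕ → E d → ℝ} {Φ : E d → E d}
    (hΦ : C1Periodic Φ) (hlim : TendstoUniformly ρs ρ atTop) :
    TendstoUniformly (fun n x => ρs n x • Φ x) (fun x => ρ x • Φ x) atTop := by
  obtain ⟨C, hC⟩ := hΦ.periodic.bounded hΦ.continuous
  refine Metric.tendstoUniformly_iff.2 fun ε hε => ?_
  have hC1 : (0 : ℝ) < C + 1 := by positivity
  filter_upwards [Metric.tendstoUniformly_iff.1 hlim (ε / (C + 1)) (div_pos hε hC1)] with n hn x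
  rw [dist_eq_norm, ← sub_smul, norm_smul]
  have h1 := hn x
  rw [dist_eq_norm, lt_div_iff₀ hC1] at h1
  refine lt_of_le_of_lt (mul_le_mul_of_nonneg_left ?_ (norm_nonneg _)) h1
  linarith [hC x]

/-- When `ρ / σ` has a positive harmonic mean, the integrable density `σ / ρ` is invariant for
`ρ • Φ`, as a limit of the invariant densities `σ / ρₙ` of the fields `ρₙ • Φ`. -/
theorem harmonicMean_smul_mem_hermanSet {ρ σ : E d → ℝ} {ρs : ℕ → E d → ℝ} {Φ : E d → E d}
    (hρ : C1Periodic ρ) (hρ0 : ∀ x, 0 ≤ ρ x) (hΦ : C1Periodic Φ)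
    (hρs : ∀ n, C1Periodic (ρs n)) (hρs_pos : ∀ n x, 0 < ρs n x)
    (hρs_ge : ∀ n x, ρ x ≤ ρs n x) (hlim : TendstoUniformly ρs ρ atTop)
    (hσ : C1Periodic σ) (hσ0 : ∀ x, 0 < σ x)
    (hσΦ : ∀ x, divergence (fun y => σ y • Φ y) x = 0)
    (hH : 0 < harmonicMean fun y => ρ y / σ y) :
    (harmonicMean fun y => ρ y / σ y).toReal • ∫ y in cell d, σ y • Φ y ∈
      hermanSet fun x => ρ x • Φ x := by
  have hmeas : Measurable fun y => (ENNReal.ofReal (ρ y / σ y))⁻¹ :=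
    (hρ.continuous.measurable.div hσ.continuous.measurable).ennreal_ofReal.inv
  have hJ : ∫⁻ y in cell d, (ENNReal.ofReal (ρ y / σ y))⁻¹ ≠ ⊤ :=
    fun h => hH.ne' (by rw [harmonicMean, h, ENNReal.inv_top])
  -- Since `1 / 0 = ∞`, integrability of `σ / ρ` in `[0, ∞]` forces `ρ > 0` almost everywhere.
  have hpos : ∀ᵐ x ∂(volume.restrict (cell d)), 0 < ρ x := by
    filter_upwards [ae_lt_top hmeas hJ] with x hx
    refine (hρ0 x).lt_of_ne' fun h => ?_
    simp [h] at hx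
  have hc0 : ∀ x, 0 ≤ σ x / ρ x := fun x => div_nonneg (hσ0 x).le (hρ0 x)
  have hcm : Measurable fun x => σ x / ρ x := hσ.continuous.measurable.div hρ.continuous.measurable
  have hci : IntegrableOn (fun x => σ x / ρ x) (cell d) := by
    refine ⟨hcm.aestronglyMeasurable, ?_⟩
    rw [hasFiniteIntegral_iff_ofReal (ae_of_all _ hc0)]
    refine lt_of_le_of_lt (le_of_eq (lintegral_congr_ae ?_)) hJ.lt_top
    filter_upwards [hpos] with x hx using (ofReal_div_inv hx (hσ0 x)).symm
  have hHr := harmonicMean_toReal_of_ae_pos hσ hσ0 hρ hpos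
  have hm : 0 < ∫ y in cell d, σ y / ρ y := by
    rw [← inv_pos, ← hHr]
    exact ENNReal.toReal_pos hH.ne' (harmonicMean_ne_top hσ hρ)
  have hb := hρ.smul hΦ
  -- The bound `σ / ρₙ ≤ σ / ρ` dominates, and `X⁽ⁿ⁾(t, ·) → X(t, ·)` for nonnegative times.
  have hinv : ∀ (t : ℝ), 0 ≤ t → ∀ (ψ : E d → ℝ), Continuous ψ → Periodic ψ →
      ∫ y in cell d, σ y / ρ y * ψ (flow (fun x => ρ x • Φ x) t y) =
        ∫ y in cell d, σ y / ρ y * ψ y := by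
    intro t ht ψ hψ hψp
    obtain ⟨M, hM⟩ := hψp.bounded hψ
    have hlim' : ∀ x, 0 < ρ x →
        Tendsto (fun n => σ x / ρs n x) atTop (𝓝 (σ x / ρ x)) := fun x hx =>
      tendsto_const_nhds.div (hlim.tendsto_at x) hx.ne'
    have hdom : ∀ (θ : ℕ → E d → ℝ) (θ' : E d → ℝ), (∀ n, Continuous (θ n)) →
        (∀ n x, ‖θ n x‖ ≤ M) → (∀ x, Tendsto (fun n => θ n x) atTop (𝓝 (θ' x))) →
        Tendsto (fun n => ∫ y in cell d, σ y / ρs n y * θ n y) atTop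
          (𝓝 (∫ y in cell d, σ y / ρ y * θ' y)) := by
      intro θ θ' hθ hθM hθl
      refine tendsto_integral_of_dominated_convergence (fun x => σ x / ρ x * M)
        (fun n => ((continuous_div_of_pos hσ (hρs n) (hρs_pos n)).mul (hθ n)).aestronglyMeasurable)
        (hci.mul_const _) (fun n => ?_) ?_
      · filter_upwards [hpos] with x hx
        rw [norm_mul, Real.norm_of_nonneg (div_pos (hσ0 x) (hρs_pos n x)).le]
        exact mul_le_mul (div_le_div_of_nonneg_left (hσ0 x).le hx (hρs_ge n x)) (hθM n x)
          (norm_nonneg _) (hc0 x)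
      · filter_upwards [hpos] with x hx using (hlim' x hx).mul (hθl x)
    refine tendsto_nhds_unique (hdom (fun n y => ψ (flow (fun x => ρs n x • Φ x) t y)) _
      (fun n => hψ.comp (continuous_flow_right ((hρs n).smul hΦ) t)) (fun n x => hM _)
      fun x => ?_) ((hdom (fun _ => ψ) ψ (fun _ => hψ) (fun _ x => hM x)
        (fun x => tendsto_const_nhds)).congr fun n => ?_)
    · exact (hψ.tendsto _).comp (tendsto_flow hb (fun n => (hρs n).smul hΦ)
        (tendstoUniformly_smul hΦ hlim) ht x)
    · refine ((isInvariant_restrict_cell (hσ.smul hΦ) hσΦ).integral_mul_comp_flow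
        ((hρs n).smul hΦ) (hσ.smul hΦ) (continuous_div_of_pos hσ (hρs n) (hρs_pos n))
        (hσ.periodic.div (hρs n).periodic) (fun x => ?_) t hψ hψp).symm
      rw [smul_smul, div_mul_cancel₀ _ (hρs_pos n x).ne']
  rw [hHr]
  have h := smul_integral_mem_hermanSet (b := fun x => ρ x • Φ x)
    (μ := volume.restrict (cell d))
    (Measure.restrict_apply_eq_zero' measurableSet_cell |>.2 (by simp)) hc0 hci hm
    (fun t ψ hψ hψp => ?_)
  · convert h using 2
    refine integral_congr_ae ?_
    filter_upwards [hpos] with x hx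
    rw [smul_smul, div_mul_cancel₀ _ hx.ne']
  · rcases le_total 0 t with ht | ht
    · exact hinv t ht ψ hψ hψp
    -- For negative `t`, apply the invariance at time `-t` to `ψ ∘ X(t, ·)`.
    · have h1 := hinv (-t) (neg_nonneg.2 ht) _ (hψ.comp (continuous_flow_right hb t))
        (periodic_comp_flow hb hψp t)
      simpa [← flow_add hb, flow_zero hb] using h1.symm

/-- The rotation vectors of `ρ • Φ` lie on the segment from `0` to the limit of the rotation
vectors of the fields `ρₙ • Φ`, whether or not the harmonic mean of `ρ / σ` vanishes. -/
theorem hermanSet_subset_segment {ρ σ : E d → ℝ} {ρs : ℕ → E d → ℝ} {Φ : E d → E d}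
    (hρ : C1Periodic ρ) (hρ0 : ∀ x, 0 ≤ ρ x) (hΦ : C1Periodic Φ)
    (hρs : ∀ n, C1Periodic (ρs n)) (hρs_pos : ∀ n x, 0 < ρs n x)
    (hρs_ge : ∀ n x, ρ x ≤ ρs n x) (hlim : TendstoUniformly ρs ρ atTop)
    (hsingleton : ∀ n, ∃ ζn : E d, hermanSet (fun x => ρs n x • Φ x) = {ζn})
    (hσ : C1Periodic σ) (hσ0 : ∀ x, 0 < σ x)
    (hσΦ : ∀ x, divergence (fun y => σ y • Φ y) x = 0) :
    hermanSet (fun x => ρ x • Φ x) ⊆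
      segment ℝ 0 ((harmonicMean fun y => ρ y / σ y).toReal • ∫ y in cell d, σ y • Φ y) := by
  rintro _ ⟨μ, hμ, rfl⟩
  have hμ1 := hμ.1
  set w := ∫ y in cell d, σ y • Φ y
  have hmean : ∀ n, ∫ y, ρ y • Φ y ∂μ =
      (∫ y, ρ y / ρs n y ∂μ) • ((harmonicMean fun y => ρs n y / σ y).toReal • w) := by
    intro n
    obtain ⟨ζ, hζ⟩ := hsingleton n
    have h1 := smul_setIntegral_mem_hermanSet hΦ hσ hσ0 hσΦ (hρs n) (hρs_pos n)
    rw [hζ, Set.mem_singleton_iff] at h1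
    rw [integral_eq_smul_of_hermanSet_eq_singleton hΦ hρ hρ0 (hρs n) (hρs_pos n) hζ hμ,
      harmonicMean_toReal_of_ae_pos hσ hσ0 (hρs n) (ae_of_all _ (hρs_pos n)), ← h1]
  have hm : ∀ n, ∫ y, ρ y / ρs n y ∂μ ∈ Set.Icc (0 : ℝ) 1 := by
    intro n
    refine ⟨integral_nonneg fun x => div_nonneg (hρ0 x) (hρs_pos n x).le, ?_⟩
    refine (integral_mono ((hρ.periodic.div (hρs n).periodic).integrable
      (continuous_div_of_pos hρ (hρs n) (hρs_pos n)) μ) (integrable_const (1 : ℝ)) fun x =>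
        (div_le_one (hρs_pos n x)).2 (hρs_ge n x)).trans (by simp)
  obtain ⟨m, hmI, φ, hφ, hmφ⟩ := isCompact_Icc.tendsto_subseq hm
  have hH : Tendsto (fun n => (harmonicMean fun y => ρs n y / σ y).toReal) atTop
      (𝓝 (harmonicMean fun y => ρ y / σ y).toReal) :=
    (ENNReal.tendsto_toReal (harmonicMean_ne_top hσ hρ)).comp (tendsto_harmonicMean
      (fun n => (hρs n).continuous.measurable.div hσ.continuous.measurable)
      (fun n x => div_le_div_of_nonneg_right (hρs_ge n x) (hσ0 x).le)
      fun x => (hlim.tendsto_at x).div_const _)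
  have h2 := hmφ.smul ((hH.comp hφ.tendsto_atTop).smul_const w)
  have h3 := tendsto_nhds_unique (tendsto_const_nhds.congr fun n => hmean (φ n)) h2
  rw [h3, segment_eq_image]
  exact ⟨m, hmI, by simp⟩

/-! ### Empirical measures of an orbit -/

instance compactSpace_closure_cell : CompactSpace (closure (cell d)) := by
  rw [← isCompact_iff_compactSpace, cell_eq_fundamentalDomain]
  exact (ZSpan.fundamentalDomain_isBounded _).isCompact_closure

/-- Along an ultrafilter of times going to infinity, the time averages of the continuous periodic
functions on an orbit converge to their means for an invariant probability measure: it is the limit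
of the empirical measures of the orbit, projected to the compact closure of the cell. -/
theorem exists_invariantMeasure_tendsto_average (hb : C1Periodic b) (x : E d)
    (U : Ultrafilter ℝ) (hU : (U : Filter ℝ) ≤ atTop) :
    ∃ μ ∈ invariantMeasures b, ∀ ψ : E d → ℝ, Continuous ψ → Periodic ψ →
      Tendsto (fun t : ℝ => t⁻¹ * ∫ s in (0 : ℝ)..t, ψ (flow b s x)) U (𝓝 (∫ y, ψ y ∂μ)) := by
  -- With the orbit rescaled to unit length, the empirical measure makes sense for every `t`.
  let g : ℝ → ℝ → closure (cell d) := fun t s =>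
    ⟨cellFract (flow b (t * s) x), subset_closure (cellFract_mem_cell _)⟩
  have hg : ∀ t, Measurable (g t) := fun t => (measurable_cellFract.comp
    ((continuous_flow_left hb x).comp (continuous_const_mul t)).measurable).subtype_mk
  have hI : IsProbabilityMeasure ((volume : Measure ℝ).restrict (Set.Ioc 0 1)) := ⟨by simp⟩
  let P : ℝ → ProbabilityMeasure (closure (cell d)) := fun t =>
    ⟨((volume : Measure ℝ).restrict (Set.Ioc 0 1)).map (g t),
      Measure.isProbabilityMeasure_map (hg t).aemeasurable⟩
  obtain ⟨Q, hQ⟩ : ∃ Q, Tendsto P U (𝓝 Q) := ⟨_, (U.map P).le_nhds_lim⟩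
  have hf : Measurable fun k : closure (cell d) => cellFract (k : E d) :=
    measurable_cellFract.comp measurable_subtype_coe
  set μ : Measure (E d) := (Q : Measure (closure (cell d))).map
    (fun k : closure (cell d) => cellFract (k : E d)) with hμ
  have hlim : ∀ ψ : E d → ℝ, Continuous ψ → Periodic ψ →
      Tendsto (fun t : ℝ => t⁻¹ * ∫ s in (0 : ℝ)..t, ψ (flow b s x)) U (𝓝 (∫ y, ψ y ∂μ)) := by
    intro ψ hψ hψp
    have h1 := ProbabilityMeasure.tendsto_iff_forall_integral_tendsto.1 hQ
      (BoundedContinuousFunction.mkOfCompact ⟨fun k => ψ k, hψ.comp continuous_subtype_val⟩)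
    have h2 : ∫ y, ψ y ∂μ = ∫ k, ψ k ∂(Q : Measure (closure (cell d))) := by
      rw [hμ, integral_map hf.aemeasurable hψ.aestronglyMeasurable]
      simp only [hψp.comp_cellFract]
    rw [h2]
    refine h1.congr' ?_
    filter_upwards [hU (eventually_ne_atTop 0)] with t ht
    change ∫ k, ψ k ∂(((volume : Measure ℝ).restrict (Set.Ioc 0 1)).map (g t)) = _
    have hψK : Continuous fun k : closure (cell d) => ψ k := hψ.comp continuous_subtype_val
    rw [integral_map (hg t).aemeasurable hψK.aestronglyMeasurable]
    simp only [g, hψp.comp_cellFract]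
    rw [← intervalIntegral.integral_of_le zero_le_one,
      intervalIntegral.integral_comp_mul_left (fun s => ψ (flow b s x)) ht]
    simp
  refine ⟨μ, ⟨Measure.isProbabilityMeasure_map hf.aemeasurable, ?_, fun τ ψ hψ hψp => ?_⟩, hlim⟩
  · have h0 : (fun k : closure (cell d) => cellFract (k : E d)) ⁻¹' (cell d)ᶜ = ∅ :=
      Set.eq_empty_of_forall_notMem fun k hk => hk (cellFract_mem_cell _)
    rw [hμ, Measure.map_apply hf measurableSet_cell.compl, h0, measure_empty]
  · have h1 := hlim _ (hψ.comp (continuous_flow_right hb τ)) (periodic_comp_flow hb hψp τ)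
    refine tendsto_nhds_unique h1 ?_
    obtain ⟨M, hM⟩ := hψp.bounded hψ
    have hc : Continuous fun s => ψ (flow b s x) := hψ.comp (continuous_flow_left hb x)
    have hi : ∀ p q : ℝ, IntervalIntegrable (fun s => ψ (flow b s x)) volume p q :=
      fun p q => hc.intervalIntegrable p q
    -- Shifting the window `[0, t]` by `τ` changes the integral by a bounded amount.
    have h2 : Tendsto (fun t : ℝ => t⁻¹ * ∫ s in (0 : ℝ)..τ,
        (ψ (flow b (s + t) x) - ψ (flow b s x))) U (𝓝 0) := by
      refine Tendsto.zero_mul_isBoundedUnder_le (tendsto_inv_atTop_zero.mono_left hU) ?_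
      refine isBoundedUnder_of ⟨(M + M) * |τ - 0|, fun t => ?_⟩
      exact intervalIntegral.norm_integral_le_of_norm_le_const fun s _ =>
        (norm_sub_le _ _).trans (add_le_add (hM _) (hM _))
    have h3 := (hlim ψ hψ hψp).add h2
    rw [add_zero] at h3
    refine h3.congr fun t => ?_
    rw [← mul_add]
    congr 1
    simp only [Function.comp, ← flow_add hb]
    have hct : Continuous fun s => ψ (flow b (s + t) x) := hc.comp (continuous_add_const t)
    rw [intervalIntegral.integral_sub (hct.intervalIntegrable 0 τ) (hi 0 τ),
      intervalIntegral.integral_comp_add_right (fun s => ψ (flow b s x)) t]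
    simp only [add_comm τ]
    rw [intervalIntegral.integral_comp_add_right (fun s => ψ (flow b s x)) τ]
    have h4 := intervalIntegral.integral_add_adjacent_intervals (hi 0 τ) (hi τ (t + τ))
    have h5 := intervalIntegral.integral_add_adjacent_intervals (hi 0 t) (hi t (t + τ))
    simp only [zero_add]
    linarith

/-- If the rotation set has at most one point, every orbit has this point as its rotation
vector. -/
theorem tendsto_inv_smul_flow_of_hermanSet_subset (hb : C1Periodic b) {ζ : E d}
    (h : hermanSet b ⊆ {ζ}) (x : E d) :
    Tendsto (fun t : ℝ => t⁻¹ • flow b t x) atTop (𝓝 ζ) := by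
  rw [tendsto_iff_ultrafilter]
  intro U hU
  obtain ⟨μ, hμ, hlim⟩ := exists_invariantMeasure_tendsto_average hb x U hU
  have hμ1 := hμ.1
  have hζ : ∫ y, b y ∂μ = ζ := h ⟨μ, hμ, rfl⟩
  have hcoord : ∀ i, Tendsto (fun t : ℝ => (t⁻¹ • flow b t x) i) U (𝓝 (ζ i)) := by
    intro i
    have hbi : Continuous fun y => b y i := (hb.apply i).contDiff.continuous
    have h1 : ∫ y, b y i ∂μ = ζ i := by
      rw [← hζ]
      exact (EuclideanSpace.proj (𝕜 := ℝ) i).integral_comp_comm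
        (hb.periodic.integrable hb.contDiff.continuous μ)
    have h2 := hlim _ hbi (hb.apply i).periodic
    have h3 : ∀ t, ∫ s in (0 : ℝ)..t, b (flow b s x) i = flow b t x i - x i := by
      intro t
      have hd : ∀ s, HasDerivAt (fun s => flow b s x i) (b (flow b s x) i) s := fun s =>
        (EuclideanSpace.proj (𝕜 := ℝ) i).hasFDerivAt.comp_hasDerivAt s (hasDerivAt_flow hb s x)
      rw [intervalIntegral.integral_eq_sub_of_hasDerivAt (fun s _ => hd s)
        ((hbi.comp (continuous_flow_left hb x)).intervalIntegrable _ _), flow_zero hb]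
    have h4 : Tendsto (fun t : ℝ => t⁻¹ * x i) U (𝓝 0) := by
      simpa using (tendsto_inv_atTop_zero.mono_left hU).mul_const (x i)
    have h5 := h2.add h4
    rw [h1, add_zero] at h5
    refine h5.congr fun t => ?_
    rw [h3, PiLp.smul_apply, smul_eq_mul]
    ring
  exact ((PiLp.continuous_toLp 2 _).tendsto _).comp (tendsto_pi_nhds.2 hcoord)

end TorusFlow

theorem mainTheorem6 {d : ℕ} (b Φ : TorusFlow.E d → TorusFlow.E d)
    (ρ σ : TorusFlow.E d → ℝ) (ρs : ℕ → TorusFlow.E d → ℝ)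
    (hb : TorusFlow.C1Periodic b) (hbρΦ : ∀ x, b x = ρ x • Φ x)
    (hρ : TorusFlow.C1Periodic ρ) (hρ_nonneg : ∀ x, 0 ≤ ρ x) (hρ_ne : ∃ x, ρ x ≠ 0)
    (hΦ : TorusFlow.C1Periodic Φ) (hΦ_ne : ∀ x, Φ x ≠ 0)
    (hρs : ∀ n, TorusFlow.C1Periodic (ρs n)) (hρs_pos : ∀ n x, 0 < ρs n x)
    (hρs_ge : ∀ n x, ρ x ≤ ρs n x) (hρs_lim : TendstoUniformly ρs ρ atTop)
    (hsingleton : ∀ n, ∃ ζn : TorusFlow.E d,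
      TorusFlow.hermanSet (fun x => ρs n x • Φ x) = {ζn})
    (hσ : TorusFlow.C1Periodic σ) (hσ_pos : ∀ x, 0 < σ x)
    (hσΦ : ∀ x, TorusFlow.divergence (fun y => σ y • Φ y) x = 0)
    (hρ_zero : ∃ x, ρ x = 0) :
    (TorusFlow.harmonicMean (fun y => ρ y / σ y) = 0 →
      ∀ x, Tendsto (fun t : ℝ => t⁻¹ • TorusFlow.flow b t x) atTop (𝓝 0)) ∧
    (0 < TorusFlow.harmonicMean (fun y => ρ y / σ y) →
      TorusFlow.hermanSet b =
        segment ℝ 0 ((TorusFlow.harmonicMean (fun y => ρ y / σ y)).toReal •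
          ∫ y in TorusFlow.cell d, σ y • Φ y)) := by
  obtain rfl : b = fun x => ρ x • Φ x := funext hbρΦ
  have hsub := TorusFlow.hermanSet_subset_segment hρ hρ_nonneg hΦ hρs hρs_pos hρs_ge hρs_lim
    hsingleton hσ hσ_pos hσΦ
  refine ⟨fun hH x => ?_, fun hH => hsub.antisymm ?_⟩
  · refine TorusFlow.tendsto_inv_smul_flow_of_hermanSet_subset hb ?_ x
    simpa [hH] using hsub
  · obtain ⟨x₀, hx₀⟩ := hρ_zero
    exact (TorusFlow.convex_hermanSet hb).segment_subset
      (TorusFlow.zero_mem_hermanSet hb (x := x₀) (by simp [hx₀]))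
      (TorusFlow.harmonicMean_smul_mem_hermanSet hρ hρ_nonneg hΦ hρs hρs_pos hρs_ge hρs_lim hσ
        hσ_pos hσΦ hH)
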